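/- Let $p$ be a prime number and let $K$ be an algebraically closed field of characteristic $p$. For a finite set $T\subset\mathbb{Z}^N$ with $m$ elements let $I_T\subset K[z_t : t\in T]$ be its toric ideal, i.e. the kernel of the $K$-algebra homomorphism $z_t\mapsto u^t=u_1^{t_1}\cdots u_N^{t_N}$ into the Laurent polynomial ring $K[u_1^{\pm1},\dots,u_N^{\pm1}]$, and let $V_T\subset K^m$ be the affine toric variety with defining ideal $I_T$. Call $V_T$ simplicial if, up to a change of parameters, $T$ consists of $m>n$ vectors of $\mathbb{N}^n$ among which are $c\mathbf{e}_1,\dots,c\mathbf{e}_n$ for some positive integer $c$, where $\mathbf{e}_1,\dots,\mathbf{e}_n$ is the canonical basis of $\mathbb{Z}^n$; here a change of parameters replaces $T$ by a finite set $S\subset\mathbb{Z}^n$ for which there is an isomorphism of groups $\mathbb{Z}T\cong\mathbb{Z}S$ restricting to a bijection $T\to S$. Proposition. If $V_T$ is simplicial and $\dim V_T\le 2$, then $V_T$ is a binomial set-theoretic complete intersection: for $r=m-\dim V_T$ there are binomials $F_1,\dots,F_r\in K[z_t : t\in T]$, each a difference of two distinct monomials with coefficient $1$, such that $I_T=\sqrt{(F_1,\dots,F_r)}$.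 -/

import Mathlib

namespace ToricSTCI

open MvPolynomial

/-- The toric ideal `I_T ⊆ K[z_t : t ∈ T]` of a finite set `T ⊆ ℤ^N`: the kernel of the
`K`-algebra homomorphism `z_t ↦ u^t`. The target is the Laurent polynomial ring
`K[u₁^±¹, …, u_N^±¹]`, written as the group algebra of `ℤ^N`, so that negative exponents are
allowed; for `T ⊆ ℕ^N` the image lies in `K[u₁, …, u_N]`. -/
noncomputable def toricIdeal (K : Type*) [Field K] {N : ℕ} (T : Finset (Fin N → ℤ)) :
    Ideal (MvPolynomial T K) :=
  RingHom.ker (aeval (fun t : T => AddMonoidAlgebra.single (t : Fin N → ℤ) (1 : K)) :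
    MvPolynomial T K →ₐ[K] AddMonoidAlgebra K (Fin N → ℤ))

/-- The dimension of the affine toric variety `V_T ⊆ K^T` with defining ideal `I_T`: the Krull
dimension of its coordinate ring. -/
noncomputable def toricDim (K : Type*) [Field K] {N : ℕ} (T : Finset (Fin N → ℤ)) :
    WithBot ℕ∞ :=
  ringKrullDim (MvPolynomial T K ⧸ toricIdeal K T)

/-- `S ⊆ ℤ^n` arises from `T ⊆ ℤ^N` by a (monomial) change of parameters: an isomorphism
`ℤT ≃ ℤS` of the generated groups which restricts to a bijection between `T` and `S`. -/
def IsChangeOfParameters {N n : ℕ} (T : Finset (Fin N → ℤ)) (S : Finset (Fin n → ℤ)) : Prop :=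
  ∃ ψ : Submodule.span ℤ (T : Set (Fin N → ℤ)) ≃ₗ[ℤ] Submodule.span ℤ (S : Set (Fin n → ℤ)),
    ∀ v : Submodule.span ℤ (T : Set (Fin N → ℤ)),
      (v : Fin N → ℤ) ∈ T ↔ (ψ v : Fin n → ℤ) ∈ S

/-- `S` consists of more than `n` vectors in `ℕ^n ⊆ ℤ^n`, among them `c e₁, …, c e_n` for some
positive integer `c`. -/
def IsSimplicialForm {n : ℕ} (S : Finset (Fin n → ℤ)) : Prop :=
  n < S.card ∧ (∀ s ∈ S, ∀ j, 0 ≤ s j) ∧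
    ∃ c : ℤ, 0 < c ∧ ∀ i : Fin n, (Pi.single i c : Fin n → ℤ) ∈ S

/-- The affine toric variety attached to `T` is simplicial: up to a change of parameters, `T`
is in simplicial form. -/
def IsSimplicial {N : ℕ} (T : Finset (Fin N → ℤ)) : Prop :=
  ∃ (n : ℕ) (S : Finset (Fin n → ℤ)), IsChangeOfParameters T S ∧ IsSimplicialForm S

/-- A binomial: the difference of two distinct monomials with coefficient `1`. -/
def IsBinomial {K : Type*} [Field K] {σ : Type*} (F : MvPolynomial σ K) : Prop :=
  ∃ a b : σ →₀ ℕ, a ≠ b ∧ F = monomial a 1 - monomial b 1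

/-- `V_T ⊆ K^T` is a binomial set-theoretic complete intersection: with `r` its codimension,
`I_T` is the radical of an ideal generated by `r` binomials. -/
def IsBinomialSTCI (K : Type*) [Field K] {N : ℕ} (T : Finset (Fin N → ℤ)) : Prop :=
  ∃ r : ℕ, (r : WithBot ℕ∞) + toricDim K T = (T.card : WithBot ℕ∞) ∧
    ∃ F : Fin r → MvPolynomial T K, (∀ i, IsBinomial (F i)) ∧
      toricIdeal K T = (Ideal.span (Set.range F)).radical

end ToricSTCI

/-! In simplicial coordinates the vectors `c e_i` generate a free semigroup, so their toric ideal is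
zero. The other vectors are adjoined one at a time, each at the cost of one binomial `z_s ^ (p^j d)
- z^w`, where `d` is the order of `v s` modulo the group spanned by the vectors already present. In
characteristic `p` this binomial suffices up to radical: the `p^j`-th power of a difference of
monomials is again such a difference, and the new binomial then eliminates `z_s`
(`monomial_sub_mem_radical_of_gluing`). A suitable `w` exists once `d • v s` lies in the group
spanned by the present vectors on the face of `v s` (`exists_pow_smul_eq_weight`). For `n ≤ 2`,
adjoining axis vectors before all others guarantees this: projection to an axis handles the former,
and the face of any other vector is the whole orthant. -/

namespace ToricSTCI

open MvPolynomial

/-! ### Toric ideals of families of vectors -/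

section Family

variable {K : Type*} [Field K] {σ M : Type*} [AddCommGroup M]

/-- The weight `∑ aᵢ vᵢ` of an exponent vector `a` with respect to a family `v`. -/
noncomputable abbrev weight (v : σ → M) : (σ →₀ ℕ) →ₗ[ℕ] M := Finsupp.linearCombination ℕ v

/-- The toric ideal of a family of vectors in an abelian group. -/
noncomputable def familyIdeal (K : Type*) [Field K] (v : σ → M) : Ideal (MvPolynomial σ K) :=
  RingHom.ker (aeval (fun i => AddMonoidAlgebra.single (v i) (1 : K)) :
    MvPolynomial σ K →ₐ[K] AddMonoidAlgebra K M)

theorem aeval_single_monomial (v : σ → M) (a : σ →₀ ℕ) (c : K) :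
    aeval (fun i => AddMonoidAlgebra.single (v i) (1 : K)) (monomial a c) =
      AddMonoidAlgebra.single (weight v a) c := by
  classical
  induction a using Finsupp.induction_linear generalizing c with
  | zero => simp [← C_apply]
  | add a b ha hb =>
    have : monomial (a + b) c = monomial a c * monomial b (1 : K) := by simp [monomial_mul]
    rw [this, map_mul, ha, hb, AddMonoidAlgebra.single_mul_single, map_add, mul_one]
  | single i k =>
    simp [aeval_monomial, AddMonoidAlgebra.single_pow, AddMonoidAlgebra.single_mul_single]

theorem monomial_sub_mem_familyIdeal {v : σ → M} {a b : σ →₀ ℕ} (h : weight v a = weight v b) :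
    monomial a (1 : K) - monomial b 1 ∈ familyIdeal K v := by
  rw [familyIdeal, RingHom.mem_ker, map_sub, aeval_single_monomial, aeval_single_monomial, h,
    sub_self]

/-- A toric ideal is generated by its binomials. -/
theorem familyIdeal_le {v : σ → M} {J : Ideal (MvPolynomial σ K)}
    (h : ∀ a b, weight v a = weight v b → monomial a (1 : K) - monomial b 1 ∈ J) :
    familyIdeal K v ≤ J := by
  intro f hf
  -- `g` picks one exponent vector per attained weight, so `L` lifts the image of `q` to a normal
  -- form congruent to `q` modulo `J`.
  let g : M → (σ →₀ ℕ) := Function.invFun (weight v)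
  have hg (a) : weight v (g (weight v a)) = weight v a := Function.invFun_eq ⟨a, rfl⟩
  let L : AddMonoidAlgebra K M →+ MvPolynomial σ K :=
    (Finsupp.liftAddHom fun m => (monomial (R := K) (g m)).toAddMonoidHom).comp
      AddMonoidAlgebra.coeffAddEquiv.toAddMonoidHom
  have hL (m : M) (c : K) : L (AddMonoidAlgebra.single m c) = monomial (g m) c := by
    change (Finsupp.liftAddHom fun m => (monomial (R := K) (g m)).toAddMonoidHom)
      (Finsupp.single m c) = _
    simp
  have key (q : MvPolynomial σ K) :
      q - L (aeval (fun i => AddMonoidAlgebra.single (v i) (1 : K)) q) ∈ J := by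
    induction q using MvPolynomial.induction_on' with
    | monomial a c =>
      rw [aeval_single_monomial, hL]
      have := J.mul_mem_left (C c) (h _ _ (hg a).symm)
      simpa [mul_sub, C_mul_monomial] using this
    | add p q hp hq =>
      rw [map_add, map_add, add_sub_add_comm]
      exact J.add_mem hp hq
  have h0 : aeval (fun i => AddMonoidAlgebra.single (v i) (1 : K)) f = 0 := hf
  have := key f
  rwa [h0, map_zero, sub_zero] at this

theorem familyIdeal_congr {M' : Type*} [AddCommGroup M'] {v : σ → M} {w : σ → M'}
    (h : ∀ a b, weight v a = weight v b ↔ weight w a = weight w b) :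
    familyIdeal K v = familyIdeal K w :=
  le_antisymm (familyIdeal_le fun a b hab => monomial_sub_mem_familyIdeal ((h a b).1 hab))
    (familyIdeal_le fun a b hab => monomial_sub_mem_familyIdeal ((h a b).2 hab))

end Family

/-- Incomparability gives `≤`; lying over and going up lift chains of primes for `≥`. -/
theorem ringKrullDim_eq_of_isIntegral {R S : Type*} [CommRing R] [CommRing S] (φ : R →+* S)
    (hφ : Function.Injective φ) (hint : φ.IsIntegral) : ringKrullDim S = ringKrullDim R := by
  let _ : Algebra R S := φ.toAlgebra
  have : Algebra.IsIntegral R S := ⟨hint⟩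
  refine le_antisymm ?_ ?_
  · exact Order.krullDim_le_of_strictMono (PrimeSpectrum.comap (algebraMap R S))
      fun I J hIJ => Ideal.IsIntegral.comap_lt_comap (R := R) (I := I.asIdeal) hIJ
  · refine iSup_le fun l => ?_
    obtain ⟨Q, -, hQ, hQ'⟩ := Ideal.exists_ideal_over_prime_of_isIntegral (R := R) (S := S)
      l.head.asIdeal ⊥ (by
        rw [← RingHom.ker_eq_comap_bot,
          (RingHom.injective_iff_ker_eq_bot (algebraMap R S)).1 hφ]
        exact bot_le)
    have : Q.LiesOver l.head.asIdeal := ⟨hQ'.symm⟩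
    obtain ⟨l', hl', -⟩ := Ideal.exists_ltSeries_of_hasGoingUp l Q
    rw [← hl']
    exact le_iSup (fun l : LTSeries (PrimeSpectrum S) => (l.length : WithBot ℕ∞)) l'

/-! ### Dimension of a simplicial toric variety -/

section Dimension

variable {K : Type*} [Field K] {σ : Type*} {n : ℕ} {v : σ → Fin n → ℤ} {c : ℤ} {f : Fin n → σ}

theorem weight_comp_single_injective {v : σ → Fin n → ℤ} {c : ℤ} {f : Fin n → σ} (hc : 0 < c)
    (hf : ∀ i, v (f i) = Pi.single i c) : Function.Injective (weight (v ∘ f)) := by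
  intro a b h
  ext i
  have h' := congrFun h i
  have e (a : Fin n →₀ ℕ) : weight (v ∘ f) a i = a i * c := by
    simp [weight, Finsupp.linearCombination_apply, Finsupp.sum_fintype, hf, Finset.sum_apply,
      Pi.single_apply]
  rw [e, e] at h'
  exact_mod_cast mul_right_cancel₀ hc.ne' h'

/-- Noether normalization: the variables of the `c e_i` are algebraically independent, and each `z_s
^ c` is a monomial in them because `c • v s = ∑ v s i • c e_i`. -/
theorem ringKrullDim_quotient_familyIdeal (hv : ∀ s j, 0 ≤ v s j) (hc : 0 < c)
    (hf : ∀ i, v (f i) = Pi.single i c) :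
    ringKrullDim (MvPolynomial σ K ⧸ familyIdeal K v) = n := by
  let φ : MvPolynomial (Fin n) K →+* MvPolynomial σ K ⧸ familyIdeal K v :=
    (Ideal.Quotient.mk (familyIdeal K v)).comp (rename f : MvPolynomial (Fin n) K →ₐ[K] _).toRingHom
  have hinj : Function.Injective φ := by
    refine (injective_iff_map_eq_zero φ).2 fun P hP => ?_
    have h1 : rename f P ∈ familyIdeal K v := Ideal.Quotient.eq_zero_iff_mem.1 hP
    have h2 : P ∈ familyIdeal K (v ∘ f) := by
      rw [familyIdeal, RingHom.mem_ker, aeval_rename] at h1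
      exact h1
    have h3 : familyIdeal K (v ∘ f) ≤ ⊥ := familyIdeal_le fun a b hab => by
      rw [weight_comp_single_injective hc hf hab, sub_self]
      exact Ideal.zero_mem _
    exact h3 h2
  have hX (s : σ) : φ.IsIntegralElem (Ideal.Quotient.mk _ (X s)) := by
    let _ : Algebra (MvPolynomial (Fin n) K) (MvPolynomial σ K ⧸ familyIdeal K v) := φ.toAlgebra
    refine IsIntegral.of_pow (R := MvPolynomial (Fin n) K) (n := c.toNat) (by omega) ?_
    let a : Fin n →₀ ℕ := Finsupp.equivFunOnFinite.symm fun i => (v s i).toNat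
    have : (Ideal.Quotient.mk (familyIdeal K v) (X s)) ^ c.toNat = φ (monomial a 1) := by
      change _ = Ideal.Quotient.mk (familyIdeal K v) (rename f (monomial a 1))
      rw [← map_pow, X_pow_eq_monomial, rename_monomial]
      refine Ideal.Quotient.eq.2 (monomial_sub_mem_familyIdeal ?_)
      rw [weight, Finsupp.linearCombination_mapDomain]
      ext i
      simp [Finsupp.linearCombination_apply, Finsupp.sum_fintype, hf, Finset.sum_apply,
        Pi.single_apply, a, hv, hc.le, mul_comm]
    rw [this]
    exact isIntegral_algebraMap
  have hint : φ.IsIntegral := by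
    intro q
    obtain ⟨P, rfl⟩ := Ideal.Quotient.mk_surjective q
    induction P using MvPolynomial.induction_on with
    | C k =>
      have : Ideal.Quotient.mk (familyIdeal K v) (C k) = φ (C k) := by simp [φ]
      rw [this]
      exact φ.isIntegralElem_map
    | add p q hp hq => rw [map_add]; exact RingHom.IsIntegralElem.add φ hp hq
    | mul_X p s hp => rw [map_mul]; exact RingHom.IsIntegralElem.mul φ hp (hX s)
  rw [ringKrullDim_eq_of_isIntegral φ hinj hint, MvPolynomial.ringKrullDim_of_isNoetherianRing]
  simp

end Dimension

/-! ### Gluing one vector in characteristic `p` -/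

section Gluing

variable {K : Type*} [Field K] {σ M : Type*} [AddCommGroup M] {v : σ → M} {n : ℕ}

/-- The equal-weight binomials in the variables from `U` lie in the radical of an ideal generated
by `|U| - n` binomials of the toric ideal. -/
def IsSTCIOn (K : Type*) [Field K] (v : σ → M) (n : ℕ) (U : Finset σ) : Prop :=
  ∃ r : ℕ, r + n = U.card ∧ ∃ F : Fin r → MvPolynomial σ K,
    (∀ i, IsBinomial (F i) ∧ F i ∈ familyIdeal K v) ∧
    ∀ a b : σ →₀ ℕ, a.support ⊆ U → b.support ⊆ U → weight v a = weight v b →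
      monomial a (1 : K) - monomial b 1 ∈ (Ideal.span (Set.range F)).radical

theorem weight_mem_span {U : Finset σ} {a : σ →₀ ℕ} (ha : a.support ⊆ U) :
    weight v a ∈ Submodule.span ℤ (v '' U) := by
  rw [weight, Finsupp.linearCombination_apply]
  refine Submodule.sum_mem _ fun i hi => ?_
  have hi' : v i ∈ Submodule.span ℤ (v '' U) := Submodule.subset_span ⟨i, ha hi, rfl⟩
  exact nsmul_mem hi' (a i)

theorem monomial_sub_mem_radical_of_gluing {p : ℕ} [Fact p.Prime] [CharP K p] {U : Finset σ}
    {s : σ} {d j : ℕ} {w : σ →₀ ℕ} {J : Ideal (MvPolynomial σ K)}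
    (hJ : ∀ a b : σ →₀ ℕ, a.support ⊆ U → b.support ⊆ U → weight v a = weight v b →
      monomial a (1 : K) - monomial b 1 ∈ J.radical)
    (hd : ∀ x : ℤ, x • v s ∈ Submodule.span ℤ (v '' U) → (d : ℤ) ∣ x)
    (hw : w.support ⊆ U) (hws : weight v w = (p ^ j * d) • v s)
    (hG : monomial (Finsupp.single s (p ^ j * d)) (1 : K) - monomial w 1 ∈ J)
    {a' b' : σ →₀ ℕ} {x y : ℕ} (hxy : y ≤ x) (ha : a'.support ⊆ U) (hb : b'.support ⊆ U)
    (h : weight v a' + x • v s = weight v b' + y • v s) :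
    monomial (a' + Finsupp.single s x) (1 : K) - monomial (b' + Finsupp.single s y) 1 ∈
      J.radical := by
  classical
  obtain ⟨z, rfl⟩ := Nat.exists_eq_add_of_le hxy
  have hz : weight v b' = weight v a' + z • v s := by
    rw [add_smul, add_comm (y • v s), ← add_assoc] at h
    exact (add_right_cancel h).symm
  have hdz : (d : ℤ) ∣ z := hd z <| by
    rw [natCast_zsmul, ← sub_eq_of_eq_add' hz]
    exact Submodule.sub_mem _ (weight_mem_span hb) (weight_mem_span ha)
  obtain ⟨q, rfl⟩ := Int.natCast_dvd_natCast.1 hdz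
  have hsupp (k : ℕ) {e : σ →₀ ℕ} (he : e.support ⊆ U) : (k • e).support ⊆ U :=
    Finsupp.support_smul.trans he
  -- After scaling by `p ^ j`, the surplus `d * q` of `v s` can be traded for `q • w`, leaving only
  -- variables from `U`.
  have h1 : monomial (p ^ j • a' + q • w) (1 : K) - monomial (p ^ j • b') 1 ∈ J.radical := by
    refine hJ _ _ (Finsupp.support_add.trans (Finset.union_subset (hsupp _ ha) (hsupp _ hw)))
      (hsupp _ hb) ?_
    rw [map_add, map_nsmul, map_nsmul, map_nsmul, hws, hz, smul_add, smul_smul, smul_smul]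
    congr 2
    ring
  have h2 : monomial (Finsupp.single s (p ^ j * d)) (1 : K) ^ q - monomial w 1 ^ q ∈ J :=
    J.mem_of_dvd (sub_dvd_pow_sub_pow _ _ q) hG
  refine Ideal.mem_radical_of_pow_mem (m := p ^ j) ?_
  rw [sub_pow_char_pow, monomial_pow, monomial_pow, one_pow]
  have e : monomial (p ^ j • (a' + Finsupp.single s (y + d * q))) (1 : K) -
      monomial (p ^ j • (b' + Finsupp.single s y)) 1 =
      monomial (p ^ j • a' + Finsupp.single s (p ^ j * y)) 1 *
        (monomial (Finsupp.single s (p ^ j * d)) (1 : K) ^ q - monomial w 1 ^ q) +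
      monomial (Finsupp.single s (p ^ j * y)) 1 *
        (monomial (p ^ j • a' + q • w) (1 : K) - monomial (p ^ j • b') 1) := by
    simp only [mul_sub, monomial_pow, monomial_mul, one_pow, mul_one]
    rw [add_sub, ← sub_sub_eq_add_sub]
    have e1 : p ^ j • (a' + Finsupp.single s (y + d * q)) =
        p ^ j • a' + Finsupp.single s (p ^ j * y) + q • Finsupp.single s (p ^ j * d) := by
      rw [smul_add, add_assoc, Finsupp.smul_single, Finsupp.smul_single, ← Finsupp.single_add]
      congr 2
      simp only [smul_eq_mul]
      ring
    have e2 : p ^ j • (b' + Finsupp.single s y) =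
        Finsupp.single s (p ^ j * y) + p ^ j • b' := by
      rw [smul_add, Finsupp.smul_single, smul_eq_mul, add_comm]
    have e3 : p ^ j • a' + Finsupp.single s (p ^ j * y) + q • w =
        Finsupp.single s (p ^ j * y) + (p ^ j • a' + q • w) := by abel
    rw [e1, e2, e3]
    ring
  rw [e]
  exact Ideal.add_mem _ (Ideal.le_radical (J.mul_mem_left _ h2)) (Ideal.mul_mem_left _ _ h1)

theorem IsSTCIOn.insert_of_gluing [DecidableEq σ] {p : ℕ} [Fact p.Prime] [CharP K p]
    {U : Finset σ} (hU : IsSTCIOn K v n U) {s : σ} (hs : s ∉ U) {d j : ℕ} (hd0 : 0 < d)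
    (hd : ∀ x : ℤ, x • v s ∈ Submodule.span ℤ (v '' U) → (d : ℤ) ∣ x)
    {w : σ →₀ ℕ} (hw : w.support ⊆ U) (hws : weight v w = (p ^ j * d) • v s) :
    IsSTCIOn K v n (insert s U) := by
  obtain ⟨r, hr, F, hF, hFU⟩ := hU
  have hp : 0 < p := (Fact.out : p.Prime).pos
  let G : MvPolynomial σ K := monomial (Finsupp.single s (p ^ j * d)) 1 - monomial w 1
  refine ⟨r + 1, by rw [Finset.card_insert_of_notMem hs]; omega, Fin.cons G F, ?_, ?_⟩
  · refine Fin.cases ⟨⟨_, _, fun h => ?_, rfl⟩, monomial_sub_mem_familyIdeal ?_⟩ hF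
    · have h1 := DFunLike.congr_fun h s
      rw [Finsupp.single_eq_same, Finsupp.notMem_support_iff.1 fun h => hs (hw h)] at h1
      exact (Nat.mul_pos (pow_pos hp j) hd0).ne' h1
    · rw [hws, weight, Finsupp.linearCombination_single]
  · set J := Ideal.span (Set.range (Fin.cons G F : Fin (r + 1) → MvPolynomial σ K))
    have hFJ : Ideal.span (Set.range F) ≤ J :=
      Ideal.span_mono (by rw [Fin.range_cons]; exact Set.subset_insert _ _)
    have hG : G ∈ J := Ideal.subset_span ⟨0, rfl⟩
    have key := fun {a' b' : σ →₀ ℕ} {x y : ℕ} => monomial_sub_mem_radical_of_gluing (p := p)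
      (a' := a') (b' := b') (x := x) (y := y)
      (fun a b ha hb hab => Ideal.radical_mono hFJ (hFU a b ha hb hab)) hd hw hws hG
    have hsupp {a : σ →₀ ℕ} (ha : a.support ⊆ insert s U) : (a.erase s).support ⊆ U := by
      rw [Finsupp.support_erase]
      exact (Finset.erase_subset_erase s ha).trans (Finset.erase_insert_subset s U)
    have hwt (a : σ →₀ ℕ) : weight v a = weight v (a.erase s) + a s • v s := by
      conv_lhs => rw [← Finsupp.erase_add_single s a]
      rw [map_add]
      simp
    intro a b ha hb hab
    rw [hwt a, hwt b] at hab
    rw [← Finsupp.erase_add_single s a, ← Finsupp.erase_add_single s b]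
    rcases le_total (b s) (a s) with h | h
    · exact key h (hsupp ha) (hsupp hb) hab
    · rw [← neg_mem_iff, neg_sub]
      exact key h (hsupp hb) (hsupp ha) hab.symm

theorem exists_dvd_of_smul_mem {P : Submodule ℤ M} {x : M} {c : ℤ} (hc : 0 < c)
    (hcx : c • x ∈ P) : ∃ d : ℕ, 0 < d ∧ d • x ∈ P ∧ ∀ k : ℤ, k • x ∈ P → (d : ℤ) ∣ k := by
  let I : Ideal ℤ := P.comap (LinearMap.toSpanSingleton ℤ M x)
  obtain ⟨g, hg⟩ := (IsPrincipalIdealRing.principal I).principal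
  have hI (k : ℤ) : k • x ∈ P ↔ g ∣ k := by
    rw [← Ideal.mem_span_singleton, ← Ideal.submodule_span_eq, ← hg]
    rfl
  refine ⟨g.natAbs, ?_, ?_, fun k hk => Int.natAbs_dvd.2 ((hI k).1 hk)⟩
  · rw [Int.natAbs_pos]
    rintro rfl
    exact hc.ne' (zero_dvd_iff.1 ((hI c).1 hcx))
  · rw [← natCast_zsmul, hI]
    exact Int.dvd_natAbs.2 dvd_rfl

end Gluing

/-! ### Faces of the orthant and the order of adjunction -/

section Cone

variable {σ : Type*} {n : ℕ} {v : σ → Fin n → ℤ} {c : ℤ} {f : Fin n → σ}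

/-- A vector of `ℕⁿ` in the group generated by those `v u` lying on its face of the orthant has
all its large multiples in the semigroup. -/
theorem exists_pow_smul_eq_weight {p : ℕ} (hp : 1 < p) (hv : ∀ s j, 0 ≤ v s j) (hc : 0 < c)
    (hf : ∀ i, v (f i) = Pi.single i c) {U : Finset σ} (hfU : ∀ i, f i ∈ U) {y : Fin n → ℤ}
    (hy : ∀ i, 0 ≤ y i)
    (hyU : y ∈ Submodule.span ℤ (v '' {u | u ∈ U ∧ ∀ i, y i = 0 → v u i = 0})) :
    ∃ (j : ℕ) (w : σ →₀ ℕ), w.support ⊆ U ∧ weight v w = p ^ j • y := by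
  classical
  let U' := U.filter fun u => ∀ i, y i = 0 → v u i = 0
  have hU' : {u | u ∈ U ∧ ∀ i, y i = 0 → v u i = 0} = (U' : Set σ) := by ext; simp [U']
  rw [hU', Finsupp.mem_span_image_iff_linearCombination] at hyU
  obtain ⟨k, hkU, hk⟩ := hyU
  rw [Finsupp.linearCombination_apply, Finsupp.sum_of_support_subset _
    ((Finsupp.mem_supported _ _).1 hkU) (fun i a => a • v i)
    fun _ _ => zero_smul _ _] at hk
  -- Each `B * k u` is divided by `c`: the remainders `r u` are kept on `v u`, and the quotients are
  -- absorbed into coefficients `m i` of `c e_i`. `S` bounds every coordinate of the remainder part.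
  let S : ℤ := ∑ u ∈ U', ∑ i, c * v u i
  let j := S.toNat
  have hj : S ≤ (p ^ j : ℕ) :=
    (Int.self_le_toNat S).trans (by exact_mod_cast (Nat.lt_pow_self hp).le)
  set B : ℕ := p ^ j
  let r : σ → ℤ := fun u => (B * k u) % c
  let m : Fin n → ℤ := fun i => ∑ u ∈ U', (B * k u) / c * v u i
  have hr0 (u) : 0 ≤ r u := Int.emod_nonneg _ hc.ne'
  have hrc (u) : r u ≤ c := (Int.emod_lt_of_pos _ hc).le
  have hyi (i) : B * y i = ∑ u ∈ U', r u * v u i + c * m i := by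
    rw [← hk, Finset.sum_apply, Finset.mul_sum, Finset.mul_sum, ← Finset.sum_add_distrib]
    refine Finset.sum_congr rfl fun u _ => ?_
    have := Int.emod_add_mul_ediv (B * k u) c
    simp only [Pi.smul_apply, smul_eq_mul, r]
    linear_combination (-v u i) * this
  have hm (i) : 0 ≤ m i := by
    -- Where `y i = 0`, the face condition kills every term; elsewhere `B * y i ≥ B ≥ S` outweighs
    -- the remainders.
    rcases (hy i).eq_or_lt with h | h
    · exact (Finset.sum_eq_zero fun u hu => by
        rw [(Finset.mem_filter.1 hu).2 i h.symm, mul_zero]).ge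
    · refine nonneg_of_mul_nonneg_right ?_ hc
      have h1 : ∑ u ∈ U', r u * v u i ≤ S := Finset.sum_le_sum fun u _ =>
        (mul_le_mul_of_nonneg_right (hrc u) (hv u i)).trans
          (Finset.single_le_sum (f := fun i => c * v u i)
            (fun i _ => mul_nonneg hc.le (hv u i)) (Finset.mem_univ i))
      have h2 : (B : ℤ) ≤ B * y i := le_mul_of_one_le_right (by positivity) h
      linarith [hyi i]
  refine ⟨j, ∑ u ∈ U', Finsupp.single u (r u).toNat + ∑ i, Finsupp.single (f i) (m i).toNat,
    ?_, ?_⟩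
  · refine Finsupp.support_add.trans (Finset.union_subset ?_ ?_)
    · refine Finsupp.support_finsetSum.trans (Finset.biUnion_subset.2 fun u hu => ?_)
      exact Finsupp.support_single_subset.trans
        (Finset.singleton_subset_iff.2 (Finset.mem_filter.1 hu).1)
    · refine Finsupp.support_finsetSum.trans (Finset.biUnion_subset.2 fun i _ => ?_)
      exact Finsupp.support_single_subset.trans (Finset.singleton_subset_iff.2 (hfU i))
  · ext i
    rw [map_add, map_sum, map_sum]
    simp only [weight, Finsupp.linearCombination_single, hf, Pi.add_apply, Finset.sum_apply,
      Pi.smul_apply, ← natCast_zsmul, Int.toNat_of_nonneg (hr0 _), Int.toNat_of_nonneg (hm _),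
      smul_eq_mul, Pi.single_apply, mul_ite, mul_zero, Finset.sum_ite_eq, Finset.mem_univ, if_true]
    rw [hyi, mul_comm c]

variable {K : Type*} [Field K]

theorem IsSTCIOn.insert_of_face [DecidableEq σ] {p : ℕ} [Fact p.Prime] [CharP K p]
    (hv : ∀ s j, 0 ≤ v s j) (hc : 0 < c) (hf : ∀ i, v (f i) = Pi.single i c) {U : Finset σ}
    (hfU : ∀ i, f i ∈ U) (hU : IsSTCIOn K v n U) {s : σ} (hs : s ∉ U)
    (hface : ∀ d : ℕ, d • v s ∈ Submodule.span ℤ (v '' U) →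
      d • v s ∈ Submodule.span ℤ (v '' {u | u ∈ U ∧ ∀ i, v s i = 0 → v u i = 0})) :
    IsSTCIOn K v n (insert s U) := by
  have hcs : c • v s ∈ Submodule.span ℤ (v '' U) := by
    have : c • v s = ∑ i, v s i • v (f i) := by
      ext i
      simp [hf, Finset.sum_apply, Pi.single_apply, mul_comm]
    rw [this]
    exact Submodule.sum_mem _ fun i _ =>
      Submodule.smul_mem _ _ (Submodule.subset_span ⟨f i, hfU i, rfl⟩)
  obtain ⟨d, hd0, hdm, hd⟩ := exists_dvd_of_smul_mem hc hcs
  have hz (i) : (d • v s) i = 0 ↔ v s i = 0 := by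
    simp [hd0.ne']
  obtain ⟨j, w, hw, hws⟩ := exists_pow_smul_eq_weight (y := d • v s)
    (Fact.out : p.Prime).one_lt hv hc hf hfU
    (fun i => nsmul_nonneg (hv s i) d) (by simpa only [hz] using hface d hdm)
  exact hU.insert_of_gluing hs hd0 hd hw (hws.trans (smul_smul _ _ _))

theorem IsSTCIOn.union_of_face [DecidableEq σ] {p : ℕ} [Fact p.Prime] [CharP K p]
    (hv : ∀ s j, 0 ≤ v s j) (hc : 0 < c) (hf : ∀ i, v (f i) = Pi.single i c) {U D : Finset σ}
    (hfU : ∀ i, f i ∈ U) (hU : IsSTCIOn K v n U)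
    (hface : ∀ s ∈ D, ∀ V ⊆ U ∪ D, ∀ d : ℕ, d • v s ∈ Submodule.span ℤ (v '' V) →
      d • v s ∈ Submodule.span ℤ (v '' {u | u ∈ V ∧ ∀ i, v s i = 0 → v u i = 0})) :
    IsSTCIOn K v n (U ∪ D) := by
  induction D using Finset.induction_on with
  | empty => simpa using hU
  | insert s D _ ih =>
    have hsub : U ∪ D ⊆ U ∪ insert s D :=
      Finset.union_subset_union_right (Finset.subset_insert s D)
    have hD := ih fun t ht V hV =>
      hface t (Finset.mem_insert_of_mem ht) V (hV.trans hsub)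
    rw [Finset.union_insert]
    by_cases hs : s ∈ U ∪ D
    · rwa [Finset.insert_eq_of_mem hs]
    · exact hD.insert_of_face hv hc hf (fun i => Finset.mem_union_left _ (hfU i)) hs
        (hface s (Finset.mem_insert_self s D) _ hsub)

theorem isSTCIOn_image [DecidableEq σ] (hc : 0 < c) (hf : ∀ i, v (f i) = Pi.single i c) :
    IsSTCIOn K v n (Finset.univ.image f) := by
  have hinj : Function.Injective f := fun i j hij => by
    by_contra h
    have := congrFun ((hf i).symm.trans ((congrArg v hij).trans (hf j))) i
    simp [h, hc.ne'] at this
  refine ⟨0, by rw [Finset.card_image_of_injective _ hinj]; simp, Fin.elim0, fun i => i.elim0,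
    fun a b ha hb hab => ?_⟩
  have hrange {a : σ →₀ ℕ} (ha : a.support ⊆ Finset.univ.image f) :
      ∃ a' : Fin n →₀ ℕ, a'.mapDomain f = a :=
    ⟨a.comapDomain f hinj.injOn, Finsupp.mapDomain_comapDomain f hinj a fun x hx => by
      simpa using ha hx⟩
  obtain ⟨a', rfl⟩ := hrange ha
  obtain ⟨b', rfl⟩ := hrange hb
  rw [weight, Finsupp.linearCombination_mapDomain, Finsupp.linearCombination_mapDomain] at hab
  rw [weight_comp_single_injective hc hf hab, sub_self]
  exact Ideal.zero_mem _

/-- Projection to the axis of `v s` fixes the generators on that axis, kills the others and fixes `d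
• v s`. -/
theorem smul_mem_span_face_of_axis {V : Finset σ} {s : σ}
    (hV : ∀ u ∈ V, ∀ i j, v u i ≠ 0 → v u j ≠ 0 → i = j)
    (hs : ∀ i j, v s i ≠ 0 → v s j ≠ 0 → i = j) {d : ℕ}
    (hd : d • v s ∈ Submodule.span ℤ (v '' V)) :
    d • v s ∈ Submodule.span ℤ (v '' {u | u ∈ V ∧ ∀ i, v s i = 0 → v u i = 0}) := by
  by_cases h0 : v s = 0
  · rw [h0, smul_zero]
    exact Submodule.zero_mem _
  obtain ⟨i, hi⟩ := Function.ne_iff.1 h0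
  let π : (Fin n → ℤ) →ₗ[ℤ] (Fin n → ℤ) := LinearMap.single ℤ (fun _ => ℤ) i ∘ₗ LinearMap.proj i
  have hπ {u : σ} (hu : ∀ i j, v u i ≠ 0 → v u j ≠ 0 → i = j) (hui : v u i ≠ 0) :
      π (v u) = v u := by
    ext j
    by_cases hj : j = i
    · subst hj
      simp [π]
    · have : v u j = 0 := by
        by_contra h
        exact hj (hu j i h hui)
      simp [π, hj, this]
  have hmap : (Submodule.span ℤ (v '' V)).map π ≤
      Submodule.span ℤ (v '' {u | u ∈ V ∧ ∀ i, v s i = 0 → v u i = 0}) := by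
    rw [Submodule.map_span, Submodule.span_le]
    rintro _ ⟨_, ⟨u, hu, rfl⟩, rfl⟩
    by_cases hui : v u i = 0
    · have : π (v u) = 0 := by simp [π, hui]
      rw [this]
      exact Submodule.zero_mem _
    · rw [hπ (hV u hu) hui]
      refine Submodule.subset_span ⟨u, ⟨hu, fun j hj => ?_⟩, rfl⟩
      by_contra h
      rw [hV u hu i j hui h] at hi
      exact hi hj
  have := hmap (Submodule.mem_map_of_mem hd)
  rwa [map_nsmul, hπ hs hi] at this

theorem isSTCIOn_univ [Fintype σ] {p : ℕ} [Fact p.Prime] [CharP K p] (hn : n ≤ 2)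
    (hv : ∀ s j, 0 ≤ v s j) (hc : 0 < c) (hf : ∀ i, v (f i) = Pi.single i c) :
    IsSTCIOn K v n Finset.univ := by
  classical
  let A : Finset σ := Finset.univ.filter fun s => ∀ i j, v s i ≠ 0 → v s j ≠ 0 → i = j
  have hA {s : σ} : s ∈ A ↔ ∀ i j, v s i ≠ 0 → v s j ≠ 0 → i = j := by simp [A]
  have hfA (i) : f i ∈ A := hA.2 fun a b ha hb => by
    rw [hf, Pi.single_apply] at ha hb
    grind
  have hsub : Finset.univ.image f ∪ A = A :=
    Finset.union_eq_right.2 (Finset.image_subset_iff.2 fun i _ => hfA i)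
  have h1 : IsSTCIOn K v n A := by
    have := (isSTCIOn_image (K := K) hc hf).union_of_face (p := p) (D := A) hv hc hf
      (fun i => Finset.mem_image_of_mem f (Finset.mem_univ i)) fun s hs V hV d hd => by
        rw [hsub] at hV
        exact smul_mem_span_face_of_axis (fun u hu => hA.1 (hV hu)) (hA.1 hs) hd
    rwa [hsub] at this
  have h2 := h1.union_of_face (p := p) (D := Aᶜ) hv hc hf hfA fun s hs V _ d hd => by
    have hpos (k) : v s k ≠ 0 := by
      rw [Finset.mem_compl, hA] at hs
      push Not at hs
      obtain ⟨i, j, hi, hj, hij⟩ := hs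
      -- Here `n ≤ 2` enters: two distinct indices exhaust `Fin n`.
      have : k = i ∨ k = j := by omega
      rcases this with rfl | rfl <;> assumption
    simpa [hpos] using hd
  rwa [Finset.union_compl] at h2

end Cone

theorem exists_family_of_isChangeOfParameters {N n : ℕ} {T : Finset (Fin N → ℤ)}
    {S : Finset (Fin n → ℤ)} (h : IsChangeOfParameters T S) :
    ∃ v : T → Fin n → ℤ, Set.range v = S ∧
      ∀ a b, weight (fun t : T => (t : Fin N → ℤ)) a = weight (fun t : T => (t : Fin N → ℤ)) b ↔
        weight v a = weight v b := by
  obtain ⟨ψ, hψ⟩ := h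
  let i : T → Submodule.span ℤ (T : Set (Fin N → ℤ)) := fun t => ⟨t, Submodule.subset_span t.2⟩
  refine ⟨fun t => ψ (i t), ?_, fun a b => ?_⟩
  · ext s
    constructor
    · rintro ⟨t, rfl⟩
      exact (hψ (i t)).1 t.2
    · intro hs
      let s' : Submodule.span ℤ (S : Set (Fin n → ℤ)) := ⟨s, Submodule.subset_span hs⟩
      refine ⟨⟨ψ.symm s', (hψ _).2 (by simpa using hs)⟩, ?_⟩
      have : i ⟨ψ.symm s', (hψ _).2 (by simpa using hs)⟩ = ψ.symm s' := rfl
      change (ψ (i _) : Fin n → ℤ) = s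
      rw [this, LinearEquiv.apply_symm_apply]
  · have h1 (a) : weight (fun t : T => (t : Fin N → ℤ)) a = (weight i a : Fin N → ℤ) := by
      simp [weight, Finsupp.linearCombination_apply, Finsupp.sum, i]
    have h2 (a) : weight (fun t : T => (ψ (i t) : Fin n → ℤ)) a = (ψ (weight i a) : Fin n → ℤ) := by
      simp [weight, Finsupp.linearCombination_apply, Finsupp.sum]
    rw [h1, h1, h2, h2, ← Subtype.ext_iff, ← Subtype.ext_iff, ψ.injective.eq_iff]

theorem isBinomialSTCI_of_isSimplicial {p : ℕ} [Fact p.Prime] {K : Type*} [Field K] [CharP K p]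
    {N : ℕ} {T : Finset (Fin N → ℤ)} (hT : IsSimplicial T) (hdim : toricDim K T ≤ 2) :
    IsBinomialSTCI K T := by
  obtain ⟨n, S, hTS, -, hS, c, hc, hcS⟩ := hT
  obtain ⟨v, hvS, hvw⟩ := exists_family_of_isChangeOfParameters hTS
  have hI : toricIdeal K T = familyIdeal K v := familyIdeal_congr hvw
  have hv (s j) : 0 ≤ v s j := hS _ (by rw [← Finset.mem_coe, ← hvS]; exact ⟨s, rfl⟩) j
  have hex (i : Fin n) : ∃ t, v t = Pi.single i c := by
    rw [← Set.mem_range, hvS]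
    exact hcS i
  choose f hf using hex
  have hd : toricDim K T = n := by
    rw [toricDim, hI]
    exact ringKrullDim_quotient_familyIdeal hv hc hf
  have hn : n ≤ 2 := by
    rw [hd] at hdim
    exact_mod_cast hdim
  obtain ⟨r, hr, F, hF, hFU⟩ := isSTCIOn_univ (K := K) (p := p) hn hv hc hf
  rw [Finset.card_univ, Fintype.card_coe] at hr
  refine ⟨r, ?_, F, fun i => (hF i).1, ?_⟩
  · rw [hd, ← hr]
    push_cast
    rfl
  · rw [hI]
    refine le_antisymm
      (familyIdeal_le fun a b => hFU a b (Finset.subset_univ _) (Finset.subset_univ _)) ?_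
    -- The group algebra of `ℤ^n` is a domain, so the toric ideal is prime, hence radical.
    have hprime : (familyIdeal K v).IsPrime := RingHom.ker_isPrime _
    rw [hprime.radical_le_iff, Ideal.span_le]
    rintro _ ⟨i, rfl⟩
    exact (hF i).2

end ToricSTCI

theorem mainTheorem7 (p : ℕ) (hp : p.Prime) (K : Type*) [Field K] [IsAlgClosed K] [CharP K p]
    (N : ℕ) (T : Finset (Fin N → ℤ)) (hT : ToricSTCI.IsSimplicial T)
    (hdim : ToricSTCI.toricDim K T ≤ 2) :
    ToricSTCI.IsBinomialSTCI K T := by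
  have : Fact p.Prime := ⟨hp⟩
  exact ToricSTCI.isBinomialSTCI_of_isSimplicial (p := p) hT hdim
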